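/- Let $\mathbb F$ be a field and, for $\omega\in\mathbb F\setminus\{0\}$ and $t,n\ge 1$, let $W_{t,\omega}(x)\in\mathbb F[x]^{t\times n}$ be the folded Wronskian, $W_{t,\omega}(x)_{i,j}=(\omega^i x)^j$ for $0\le i<t$, $0\le j<n$. An indexed collection $\mathcal E$ of matrices in $\mathbb F^{t\times n}$ is a $(\le r,\varepsilon)$-lossy rank condenser if for all $1\le s\le r$ and all $A\in\mathbb F^{n\times s}$ of rank $s$ there is $E\in\mathcal E$ with $\operatorname{rank}(EA)\ge(1-\varepsilon)s$; equivalently, every subspace of $\mathbb F^n$ of dimension $s\le r$ is mapped by some $E\in\mathcal E$ onto a space of dimension at least $(1-\varepsilon)s$. Let $n,t\ge r\ge 1$ and $\varepsilon>0$, and put $N=\left\lceil \frac{n}{\varepsilon(t-r+1)}\right\rceil$. (1) Let $\omega\in\mathbb F$ have multiplicative order at least $n$ (possibly infinite), let $\ell\ge t$ and $S\subseteq\{(\omega^\ell)^j: j\ge 0\}$. Suppose that $|S|\ge n^2$, or that $|S|\ge N$ and the elements $\omega^i\alpha$ ($\alpha\in S$, $0\le i<t$) are pairwise distinct. Then $\{W_{t,\omega}(\alpha):\alpha\in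 S\}$ is a $(\le r,\varepsilon)$-lossy rank condenser. (2) Let $K\ge\min\{N,n^2\}$ and let $\omega\in\mathbb F$ have multiplicative order at least $n$ and at least $tK$. Then the powers $(\omega^t)^j$, $0\le j<K$, are pairwise distinct, and the matrices $W_{t,\omega}((\omega^t)^j)$, $0\le j<K$, form a $(\le r,\varepsilon)$-lossy rank condenser. (3) If $|\mathbb F|>tn^2$, then for every $M\ge N$ there is an explicit $(\le r,\varepsilon)$-lossy rank condenser of size $M$ in $\mathbb F^{t\times n}$. More precisely, there are a single algorithm $P$ and a single polynomial bound, independent of $\mathbb F,n,t,M,r,\varepsilon$, with the following property. Let $P$ be run over any field $\mathbb F$, as a random access machine with unit-cost field operations and equality tests, addition, subtraction and comparison of natural numbers, and access to a list of distinct elements of $\mathbb F$ (a list of all its elements if $\mathbb F$ is finite, an infinite list otherwise). For all $n,t\ge 1$ with $|\mathbb F|>tn^2$ and all $M$ there are $\omega\in\mathbb F$ of multiplicative order at least $tn^2$ and matrices $E_0,\dots,E_{M-1}\in\mathbb F^{t\times n}$, with $E_i=W_{t,\omega}((\omega^t)^i)$ for $i<n^2$ and $E_i=0$ for $i\ge n^2$,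 such that on input $(n,t,M,i)$ with $i<M$ the algorithm outputs $E_i$ after at most $\operatorname{poly}(t,n,\log M)$ steps; and for all $r\ge 1$ with $r\le n$, $r\le t$ and all $\varepsilon>0$ with $N\le M$, the collection $(E_i)_{i<M}$ is a $(\le r,\varepsilon)$-lossy rank condenser. -/

import Mathlib

universe u

namespace RankCondenser

/-- `ω` is a nonzero element whose multiplicative order is at least `m`
(`orderOf ω = 0` is the case of infinite order). -/
def OrderAtLeast {F : Type u} [Field F] (ω : F) (m : ℕ) : Prop :=
  ω ≠ 0 ∧ (orderOf ω = 0 ∨ m ≤ orderOf ω)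

/-- The folded Wronskian `Wr_{t,ω}(x)`: the `t × n` matrix over `F[x]` with entries `(ω^i x)^j`,
rows and columns indexed from zero. -/
noncomputable def foldedWronskian {F : Type u} [Field F] (t n : ℕ) (ω : F) :
    Matrix (Fin t) (Fin n) (Polynomial F) :=
  Matrix.of fun i j => (Polynomial.C (ω ^ (i : ℕ)) * Polynomial.X) ^ (j : ℕ)

/-- The folded Wronskian evaluated at the point `α`. -/
noncomputable def foldedWronskianAt {F : Type u} [Field F] (t n : ℕ) (ω α : F) :
    Matrix (Fin t) (Fin n) F :=
  (foldedWronskian t n ω).map (Polynomial.eval α)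

/-- An indexed collection `E` of `t × n` matrices is an `(r, ε)`-lossy rank condenser. -/
def IsLossyCondenser {F : Type u} [Field F] {ι : Type*} {t n : ℕ}
    (E : ι → Matrix (Fin t) (Fin n) F) (r : ℕ) (ε : ℝ) : Prop :=
  ∀ A : Matrix (Fin n) (Fin r) F, A.rank = r →
    ∃ k : ι, (1 - ε) * (A.rank : ℝ) ≤ ((E k * A).rank : ℝ)

/-- An indexed collection `E` of `t × n` matrices is a `(≤ r, ε)`-lossy rank condenser. -/
def IsLossyCondenserLE {F : Type u} [Field F] {ι : Type*} {t n : ℕ}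
    (E : ι → Matrix (Fin t) (Fin n) F) (r : ℕ) (ε : ℝ) : Prop :=
  ∀ s : ℕ, 1 ≤ s → s ≤ r → IsLossyCondenser E s ε

/-- `N = ⌈n / (ε (t - r + 1))⌉`. -/
noncomputable def seedSize (n t r : ℕ) (ε : ℝ) : ℕ :=
  ⌈(n : ℝ) / (ε * ((t : ℝ) - (r : ℝ) + 1))⌉₊

/-! ### Algorithms over a field

A random access machine with registers holding natural numbers and registers holding field
elements, programmed in a structured language.  A program does not depend on the field.  Every
instruction and every test costs one step.  On natural numbers there are only addition, truncated
subtraction and comparison, so that the unit cost is polynomially related to the bit cost. -/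

/-- Contents of the memory, and the list of field elements written so far. -/
structure State (F : Type u) where
  nat : ℕ → ℕ
  fld : ℕ → F
  out : List F

/-- Elementary instructions; arguments are register addresses (`k` in `natConst` is a constant). -/
inductive Instr where
  | natConst (a k : ℕ)
  | natMove (a b : ℕ)
  | natAdd (a b c : ℕ)
  | natSub (a b c : ℕ)
  | natLoad (a b : ℕ)
  | natStore (a b : ℕ)
  | fldZero (a : ℕ)
  | fldOne (a : ℕ)
  | fldMove (a b : ℕ)
  | fldAdd (a b c : ℕ)
  | fldSub (a b c : ℕ)
  | fldMul (a b c : ℕ)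
  | fldInv (a b : ℕ)
  | fldLoad (a b : ℕ)
  | fldStore (a b : ℕ)
  | fldElem (a b : ℕ)
  | write (a : ℕ)

/-- Effect of an instruction.  The function `e` gives access to the elements of the field:
`fldElem a b` fetches the field element whose number is in the natural-number register `b`. -/
def Instr.apply {F : Type u} [Field F] (e : ℕ → F) (s : State F) : Instr → State F
  | .natConst a k => { s with nat := Function.update s.nat a k }
  | .natMove a b => { s with nat := Function.update s.nat a (s.nat b) }
  | .natAdd a b c => { s with nat := Function.update s.nat a (s.nat b + s.nat c) }
  | .natSub a b c => { s with nat := Function.update s.nat a (s.nat b - s.nat c) }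
  | .natLoad a b => { s with nat := Function.update s.nat a (s.nat (s.nat b)) }
  | .natStore a b => { s with nat := Function.update s.nat (s.nat a) (s.nat b) }
  | .fldZero a => { s with fld := Function.update s.fld a 0 }
  | .fldOne a => { s with fld := Function.update s.fld a 1 }
  | .fldMove a b => { s with fld := Function.update s.fld a (s.fld b) }
  | .fldAdd a b c => { s with fld := Function.update s.fld a (s.fld b + s.fld c) }
  | .fldSub a b c => { s with fld := Function.update s.fld a (s.fld b - s.fld c) }
  | .fldMul a b c => { s with fld := Function.update s.fld a (s.fld b * s.fld c) }
  | .fldInv a b => { s with fld := Function.update s.fld a (s.fld b)⁻¹ }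
  | .fldLoad a b => { s with fld := Function.update s.fld a (s.fld (s.nat b)) }
  | .fldStore a b => { s with fld := Function.update s.fld (s.nat a) (s.fld b) }
  | .fldElem a b => { s with fld := Function.update s.fld a (e (s.nat b)) }
  | .write a => { s with out := s.out ++ [s.fld a] }

/-- Tests: comparison of two natural-number registers, equality of two field registers. -/
inductive Test where
  | natLt (a b : ℕ)
  | fldEq (a b : ℕ)

/-- The condition that a test checks. -/
def Test.Holds {F : Type u} (s : State F) : Test → Prop
  | .natLt a b => s.nat a < s.nat b
  | .fldEq a b => s.fld a = s.fld b

/-- Programs. -/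
inductive Program where
  | skip
  | instr (i : Instr)
  | seq (p q : Program)
  | ite (c : Test) (p q : Program)
  | loop (c : Test) (p : Program)

/-- `Exec e p s s' k`: the program `p`, started in the state `s`, halts in the state `s'` after
exactly `k` steps (`loop c p` is "while `c` do `p`"). -/
inductive Exec {F : Type u} [Field F] (e : ℕ → F) :
    Program → State F → State F → ℕ → Prop where
  | skip (s : State F) : Exec e .skip s s 0
  | instr (i : Instr) (s : State F) : Exec e (.instr i) s (i.apply e s) 1
  | seq {p q : Program} {s s' s'' : State F} {k l : ℕ} :
      Exec e p s s' k → Exec e q s' s'' l → Exec e (.seq p q) s s'' (k + l)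
  | iteTrue {c : Test} {p q : Program} {s s' : State F} {k : ℕ} :
      c.Holds s → Exec e p s s' k → Exec e (.ite c p q) s s' (k + 1)
  | iteFalse {c : Test} {p q : Program} {s s' : State F} {k : ℕ} :
      ¬ c.Holds s → Exec e q s s' k → Exec e (.ite c p q) s s' (k + 1)
  | loopTrue {c : Test} {p : Program} {s s' s'' : State F} {k l : ℕ} :
      c.Holds s → Exec e p s s' k → Exec e (.loop c p) s' s'' l →
        Exec e (.loop c p) s s'' (k + l + 1)
  | loopFalse {c : Test} {p : Program} {s : State F} :
      ¬ c.Holds s → Exec e (.loop c p) s s 1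

/-- Start: the input numbers are in the first natural-number registers, everything else is zero. -/
def startState (F : Type u) [Field F] (input : List ℕ) : State F where
  nat := fun a => input.getD a 0
  fld := fun _ => 0
  out := []

/-- On the given input, the program halts after at most `T` steps and has written `output`. -/
def OutputsWithin {F : Type u} [Field F] (e : ℕ → F) (p : Program) (input : List ℕ)
    (output : List F) (T : ℕ) : Prop :=
  ∃ (s : State F) (k : ℕ), Exec e p (startState F input) s k ∧ s.out = output ∧ k ≤ T

/-- `e` lists distinct elements of `F`: `e 0, …, e (|F| - 1)` are distinct if `F` is finite, and
`e` is injective if `F` is infinite. -/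
def ListsDistinct {F : Type u} (e : ℕ → F) : Prop :=
  ∀ i j : ℕ, i < j → (j : ℕ∞) < ENat.card F → e i ≠ e j

/-- The entries of a matrix, row by row. -/
def rowMajor {F : Type u} {t n : ℕ} (A : Matrix (Fin t) (Fin n) F) : List F :=
  (List.ofFn fun i => List.ofFn fun j => A i j).flatten

end RankCondenser

/-!
A matrix `A` of rank `s` with `n` rows is read as a list of `s` linearly independent polynomials
`f_k` of degree less than `n`, the columns being the coefficient vectors.  The product of the folded
Wronskian at `α` with `A` then has the entries `f_k (ω ^ i * α)`, and everything is controlled by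
the one-variable polynomial `D(x) = det (f_k (ω ^ i * x))` with `i, k < s` (`foldedDet`).

* `D` is nonzero if `1, ω, …, ω ^ (n - 1)` are distinct (`foldedDet_ne_zero`): column operations make
  the degrees of the `f_k` distinct, and then the top coefficient of `D` is a Vandermonde
  determinant in the elements `ω ^ deg f_k` times the leading coefficients.  Its degree is at most
  `s * (n - 1)`.
* The rows `j, …, j + s - 1` of the product at `α` are the matrix of `D` at `ω ^ j * α`.  So if the
  product at `α` has rank `s - m`, then `D` vanishes to order `m` at each of the `t - s + 1` points
  `ω ^ j * α` (`X_sub_C_pow_dvd_foldedDet`).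

If these points are distinct for all `α` in `S` and every `α` loses more than `ε * s` dimensions,
then `|S| * (t - s + 1) * ε * s ≤ s * (n - 1)`, which contradicts `|S| ≥ n / (ε * (t - r + 1))`.  And
`n ^ 2` points are too many to be all roots of `D`; outside the roots no dimension is lost.

The algorithm tries the listed field elements one after the other until it meets one of order at
least `m = t * n ^ 2`, which it recognizes by computing its powers.  At most `m ^ 2 + 1` elements have
to be tried (`exists_orderAtLeast_of_listsDistinct`): elements of smaller order are roots of
`X * ∏ (X ^ k - 1)`, `1 ≤ k < m`, and a field with at most `m ^ 2` elements has been listed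
completely, including a generator of its multiplicative group.  The entries of the matrix are then
written as successive powers.  The correctness and the running time of the program are verified in a
small program logic (`Runs`), loops being treated by invariants indexed by the number of rounds.
-/

namespace RankCondenser

open Polynomial Matrix

/-! ### Determinants of polynomial matrices -/

section Determinants

variable {F : Type u} [Field F]

theorem natDegree_prod_le_sum {ι : Type*} (s : Finset ι) (f : ι → F[X]) (d : ι → ℕ)
    (h : ∀ i ∈ s, (f i).natDegree ≤ d i) : (∏ i ∈ s, f i).natDegree ≤ ∑ i ∈ s, d i :=
  (natDegree_prod_le s f).trans (Finset.sum_le_sum h)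

theorem coeff_prod_sum_of_natDegree_le {ι : Type*} (s : Finset ι) (f : ι → F[X]) (d : ι → ℕ)
    (h : ∀ i ∈ s, (f i).natDegree ≤ d i) :
    (∏ i ∈ s, f i).coeff (∑ i ∈ s, d i) = ∏ i ∈ s, (f i).coeff (d i) := by
  classical
  induction s using Finset.induction_on with
  | empty => simp
  | insert a s ha ih =>
    rw [Finset.prod_insert ha, Finset.sum_insert ha, Finset.prod_insert ha,
      coeff_mul_add_eq_of_natDegree_le (h a (Finset.mem_insert_self a s))
        (natDegree_prod_le_sum s f d fun i hi => h i (Finset.mem_insert_of_mem hi)),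
      ih fun i hi => h i (Finset.mem_insert_of_mem hi)]

theorem natDegree_det_le_sum {s : ℕ} (M : Matrix (Fin s) (Fin s) F[X]) (d : Fin s → ℕ)
    (h : ∀ i k, (M i k).natDegree ≤ d k) : M.det.natDegree ≤ ∑ k, d k := by
  rw [det_apply]
  refine natDegree_sum_le_of_forall_le _ _ fun σ _ => ?_
  refine (natDegree_smul_le _ _).trans ?_
  exact natDegree_prod_le_sum _ _ _ fun i _ => h _ _

theorem coeff_det_sum {s : ℕ} (M : Matrix (Fin s) (Fin s) F[X]) (d : Fin s → ℕ)
    (h : ∀ i k, (M i k).natDegree ≤ d k) :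
    M.det.coeff (∑ k, d k) = (Matrix.of fun i k => (M i k).coeff (d k)).det := by
  rw [det_apply, det_apply, finsetSum_coeff]
  refine Finset.sum_congr rfl fun σ _ => ?_
  rw [Polynomial.coeff_smul, coeff_prod_sum_of_natDegree_le _ _ _ fun i _ => h _ _]
  rfl

/-- A corank of `m` at the point `β` forces a zero of order `m` of the determinant: after row and
column operations over the field, `m` columns vanish at `β`. -/
theorem X_sub_C_pow_corank_dvd_det {s : ℕ} (M : Matrix (Fin s) (Fin s) F[X]) (β : F) :
    (X - C β) ^ (s - (M.map (eval β)).rank) ∣ M.det := by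
  classical
  obtain ⟨L, L', D, hD⟩ :=
    Pivot.exists_list_transvec_mul_mul_list_transvec_eq_diagonal (M.map (eval β))
  set P := (L.map TransvectionStruct.toMatrix).prod with hP
  set Q := (L'.map TransvectionStruct.toMatrix).prod with hQ
  have hPd : P.det = 1 := TransvectionStruct.det_toMatrix_prod L
  have hQd : Q.det = 1 := TransvectionStruct.det_toMatrix_prod L'
  have hrank : (M.map (eval β)).rank = Fintype.card {k // D k ≠ 0} := by
    rw [← rank_diagonal, ← hD, rank_mul_eq_left_of_isUnit_det _ _ (by simp [hQd]),
      rank_mul_eq_right_of_isUnit_det _ _ (by simp [hPd])]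
  have hcard : s - (M.map (eval β)).rank = (Finset.univ.filter fun k => D k = 0).card := by
    have h1 := Finset.card_filter_add_card_filter_not (s := (Finset.univ : Finset (Fin s)))
      (fun k => D k = 0)
    rw [hrank, Fintype.card_subtype]
    simp only [Finset.card_univ, Fintype.card_fin] at h1
    simp only [ne_eq]
    omega
  set M' : Matrix (Fin s) (Fin s) F[X] := P.map C * M * Q.map C with hM'
  have hdet : M'.det = M.det := by
    have e1 : (P.map C).det = 1 := by
      have := RingHom.map_det (C : F →+* F[X]) P
      rw [hPd, map_one] at this
      exact this.symm
    have e2 : (Q.map C).det = 1 := by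
      have := RingHom.map_det (C : F →+* F[X]) Q
      rw [hQd, map_one] at this
      exact this.symm
    rw [hM', det_mul, det_mul, e1, e2, one_mul, mul_one]
  have heval : M'.map (eval β) = diagonal D := by
    rw [← hD]
    change M'.map (evalRingHom β) = P * M.map (evalRingHom β) * Q
    rw [hM', Matrix.map_mul, Matrix.map_mul]
    have e : ∀ R : Matrix (Fin s) (Fin s) F, (R.map C).map (evalRingHom β) = R := by
      intro R
      ext i j
      simp
    rw [e, e]
  rw [hcard, ← hdet, det_apply]
  refine Finset.dvd_sum fun σ _ => ?_
  rw [Units.smul_def, zsmul_eq_mul]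
  refine Dvd.dvd.mul_left ?_ _
  rw [← Finset.prod_const]
  refine (Finset.prod_dvd_prod_of_dvd _ (fun k => M' (σ k) k) fun k hk => ?_).trans
    (Finset.prod_dvd_prod_of_subset _ _ _ (Finset.filter_subset _ _))
  rw [dvd_iff_isRoot, IsRoot.def]
  have := congrFun (congrFun heval (σ k)) k
  rw [Matrix.map_apply] at this
  rw [this, diagonal_apply]
  split_ifs with h
  · rw [h]
    exact (Finset.mem_filter.1 hk).2
  · rfl

/-! ### The folded determinant of a family of polynomials -/

/-- The `s × s` determinant `det (f_k (ω ^ i * x))` of a family of `s` polynomials. -/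
noncomputable def foldedDet {s : ℕ} (ω : F) (f : Fin s → F[X]) : F[X] :=
  (Matrix.of fun i k : Fin s => (f k).comp (C (ω ^ (i : ℕ)) * X)).det

theorem natDegree_comp_C_mul_X_le (p : F[X]) (a : F) :
    (p.comp (C a * X)).natDegree ≤ p.natDegree :=
  natDegree_comp_le.trans 
    ((Nat.mul_le_mul_left _ ((natDegree_C_mul_le a X).trans natDegree_X_le)).trans (mul_one _).le)

theorem natDegree_foldedDet_le {s n : ℕ} (ω : F) (f : Fin s → F[X])
    (h : ∀ k, (f k).natDegree < n) : (foldedDet ω f).natDegree ≤ s * (n - 1) := by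
  refine (natDegree_det_le_sum _ (fun _ => n - 1) fun i k => ?_).trans (by simp)
  exact (natDegree_comp_C_mul_X_le _ _).trans (Nat.le_sub_one_of_lt (h k))

/-- If the degrees are distinct, then the top coefficient of the folded determinant is, up to the
leading coefficients of the family, a Vandermonde determinant at distinct powers of `ω`. -/
theorem foldedDet_ne_zero_of_injective {s n : ℕ} {ω : F}
    (hω : Set.InjOn (fun j : ℕ => ω ^ j) (Set.Iio n)) (f : Fin s → F[X]) (hf : ∀ k, f k ≠ 0)
    (hd : ∀ k, (f k).natDegree < n) (hinj : Function.Injective fun k => (f k).natDegree) :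
    foldedDet ω f ≠ 0 := by
  intro h0
  have hc := coeff_det_sum (Matrix.of fun i k : Fin s => (f k).comp (C (ω ^ (i : ℕ)) * X))
    (fun k => (f k).natDegree) fun i k => natDegree_comp_C_mul_X_le _ _
  change (foldedDet ω f).coeff _ = _ at hc
  rw [h0, coeff_zero] at hc
  have hM : (Matrix.of fun i k : Fin s =>
      ((Matrix.of fun i k : Fin s => (f k).comp (C (ω ^ (i : ℕ)) * X)) i k).coeff
        (f k).natDegree) =
      (vandermonde fun k => ω ^ (f k).natDegree)ᵀ * diagonal fun k => (f k).leadingCoeff := by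
    ext i k
    rw [mul_diagonal]
    simp only [of_apply, transpose_apply, vandermonde_apply, comp_C_mul_X_coeff, leadingCoeff]
    rw [mul_comm, ← pow_mul, ← pow_mul, mul_comm (i : ℕ)]
  rw [hM, det_mul, det_transpose, det_diagonal] at hc
  rcases mul_eq_zero.1 hc.symm with h | h
  · refine det_vandermonde_ne_zero_iff.2 (fun a b hab => hinj ?_) h
    exact hω (hd a) (hd b) hab
  · obtain ⟨k, -, hk⟩ := Finset.prod_eq_zero_iff.1 h
    exact hf k (leadingCoeff_eq_zero.1 hk)

/-- Subtracting a multiple of one member of a family from another one is a column operation. -/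
theorem foldedDet_update_sub {s : ℕ} (ω : F) (f : Fin s → F[X]) {k l : Fin s} (hkl : k ≠ l)
    (c : F) : foldedDet ω (Function.update f k (f k - C c * f l)) = foldedDet ω f := by
  unfold foldedDet
  rw [← det_updateCol_add_smul_self (Matrix.of fun i k : Fin s =>
    (f k).comp (C (ω ^ (i : ℕ)) * X)) hkl (-C c)]
  congr 1
  ext1 i j
  by_cases hj : j = k
  · subst hj
    simp [sub_eq_add_neg]
  · simp [hj]

theorem linearIndependent_update_sub {s : ℕ} {f : Fin s → F[X]} (hf : LinearIndependent F f)
    {k l : Fin s} (hkl : k ≠ l) (c : F) :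
    LinearIndependent F (Function.update f k (f k - C c * f l)) := by
  rw [Fintype.linearIndependent_iff] at hf ⊢
  intro g hg
  have key : ∑ i, Function.update g l (g l - c * g k) i • f i = 0 := by
    rw [← hg, ← sub_eq_zero, ← Finset.sum_sub_distrib,
      Fintype.sum_eq_add k l hkl]
    · simp only [Function.update_self, Function.update_of_ne hkl, Function.update_of_ne hkl.symm,
        smul_eq_C_mul, C_sub, C_mul]
      ring
    · rintro i ⟨hk, hl⟩
      simp [hk, hl]
  have h := hf _ key
  have hk : g k = 0 := by simpa [hkl] using h k
  intro i
  by_cases hi : i = l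
  · subst hi
    simpa [hk] using h i
  · simpa [hi] using h i

/-- The folded determinant of linearly independent polynomials of degree less than `n` is nonzero
if `1, ω, …, ω ^ (n - 1)` are distinct.  As long as two degrees agree, one of them can be lowered
without changing the determinant. -/
theorem foldedDet_ne_zero {s n : ℕ} {ω : F}
    (hω : Set.InjOn (fun j : ℕ => ω ^ j) (Set.Iio n)) (f : Fin s → F[X])
    (hf : LinearIndependent F f) (hd : ∀ k, (f k).natDegree < n) : foldedDet ω f ≠ 0 := by
  induction hN : ∑ k, (f k).natDegree using Nat.strong_induction_on generalizing f with
  | _ N ih =>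
    by_cases hinj : Function.Injective fun k => (f k).natDegree
    · exact foldedDet_ne_zero_of_injective hω f (fun k => hf.ne_zero k) hd hinj
    simp only [Function.Injective, not_forall] at hinj
    obtain ⟨k, l, hdeg, hkl⟩ := hinj
    set c := (f k).leadingCoeff / (f l).leadingCoeff with hc
    have hli := linearIndependent_update_sub hf hkl c
    have hlc : (f l).leadingCoeff ≠ 0 := leadingCoeff_ne_zero.2 (hf.ne_zero l)
    have hc0 : c ≠ 0 := div_ne_zero (leadingCoeff_ne_zero.2 (hf.ne_zero k)) hlc
    have hlt : (f k - C c * f l).natDegree < (f k).natDegree := by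
      have hne : f k - C c * f l ≠ 0 := by simpa using hli.ne_zero k
      refine natDegree_lt_natDegree hne (degree_sub_lt_left ?_ (hf.ne_zero k) ?_)
      · rw [degree_C_mul hc0, degree_eq_natDegree (hf.ne_zero k),
          degree_eq_natDegree (hf.ne_zero l), hdeg]
      · rw [leadingCoeff_mul, leadingCoeff_C, hc, div_mul_cancel₀ _ hlc]
    rw [← foldedDet_update_sub ω f hkl c]
    refine ih _ ?_ _ hli ?_ rfl
    · rw [← hN]
      refine Finset.sum_lt_sum (fun i _ => ?_) ⟨k, Finset.mem_univ _, by simpa using hlt⟩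
      by_cases hi : i = k
      · subst hi
        simpa using hlt.le
      · simp [hi]
    · intro i
      by_cases hi : i = k
      · subst hi
        simpa using hlt.trans (hd i)
      · simpa [hi] using hd i

/-! ### Rank of the folded Wronskian times a matrix -/

/-- The columns of a matrix, read as coefficient vectors of polynomials. -/
noncomputable def colPoly {n s : ℕ} (A : Matrix (Fin n) (Fin s) F) (k : Fin s) : F[X] :=
  ∑ j : Fin n, C (A j k) * X ^ (j : ℕ)

theorem coeff_colPoly {n s : ℕ} (A : Matrix (Fin n) (Fin s) F) (k : Fin s) (j : Fin n) :
    (colPoly A k).coeff j = A j k := by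
  simp [colPoly, coeff_C_mul, coeff_X_pow, Fin.val_inj]

theorem natDegree_colPoly_lt {n s : ℕ} (hn : 1 ≤ n) (A : Matrix (Fin n) (Fin s) F) (k : Fin s) :
    (colPoly A k).natDegree < n := by
  refine Nat.lt_of_le_sub_one hn (natDegree_sum_le_of_forall_le _ _ fun j _ => ?_)
  exact (natDegree_C_mul_X_pow_le _ _).trans (Nat.le_sub_one_of_lt j.2)

theorem linearIndependent_colPoly {n s : ℕ} {A : Matrix (Fin n) (Fin s) F} (hA : A.rank = s) :
    LinearIndependent F (colPoly A) := by
  have hcol : LinearIndependent F A.col := by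
    rw [linearIndependent_iff_card_eq_finrank_span, Set.finrank, ← rank_eq_finrank_span_cols, hA,
      Fintype.card_fin]
  rw [Fintype.linearIndependent_iff] at hcol ⊢
  intro g hg
  refine hcol g (funext fun j => ?_)
  have := congrArg (fun p : F[X] => p.coeff j) hg
  simpa [finsetSum_coeff, coeff_colPoly] using this

theorem foldedWronskianAt_apply {t n : ℕ} (ω α : F) (i : Fin t) (j : Fin n) :
    foldedWronskianAt t n ω α i j = (ω ^ (i : ℕ) * α) ^ (j : ℕ) := by
  simp [foldedWronskianAt, foldedWronskian]

theorem foldedWronskianAt_mul_apply {t n s : ℕ} (ω α : F) (A : Matrix (Fin n) (Fin s) F)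
    (i : Fin t) (k : Fin s) :
    (foldedWronskianAt t n ω α * A) i k = (colPoly A k).eval (ω ^ (i : ℕ) * α) := by
  rw [mul_apply, colPoly, eval_finsetSum]
  refine Finset.sum_congr rfl fun j _ => ?_
  rw [foldedWronskianAt_apply, eval_mul, eval_C, eval_pow, eval_X, mul_comm]

/-- The rows `j, …, j + s - 1` of the folded Wronskian at `α` form the square folded Wronskian at
`ω ^ j * α`, so that its corank at `α` bounds from below the order of the zero of the folded
determinant at `ω ^ j * α`. -/
theorem X_sub_C_pow_dvd_foldedDet {t n s : ℕ} (ω α : F) (A : Matrix (Fin n) (Fin s) F) {j : ℕ}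
    (hj : j + s ≤ t) :
    (X - C (ω ^ j * α)) ^ (s - (foldedWronskianAt t n ω α * A).rank) ∣
      foldedDet ω (colPoly A) := by
  refine (pow_dvd_pow _ ?_).trans (X_sub_C_pow_corank_dvd_det _ (ω ^ j * α))
  refine Nat.sub_le_sub_left ?_ s
  have : (Matrix.of fun i k : Fin s => (colPoly A k).comp (C (ω ^ (i : ℕ)) * X)).map
      (eval (ω ^ j * α)) = (foldedWronskianAt t n ω α * A).submatrix
        (fun i : Fin s => (⟨j + i, by omega⟩ : Fin t)) id := by
    ext i k
    simp only [map_apply, of_apply, submatrix_apply, id, foldedWronskianAt_mul_apply, eval_comp,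
      eval_mul, eval_C, eval_X, pow_add]
    congr 1
    ring
  rw [this]
  exact rank_submatrix_le _ _ _

/-! ### Counting the points of large corank -/

/-- The total corank over a set of points with distinct translates `ω ^ i * α` is bounded through
the degree of the folded determinant. -/
theorem sum_corank_mul_le {t n s : ℕ} {ω : F} (hn : 1 ≤ n) (hs : 1 ≤ s) (hst : s ≤ t)
    (hω : Set.InjOn (fun j : ℕ => ω ^ j) (Set.Iio n)) {A : Matrix (Fin n) (Fin s) F}
    (hA : A.rank = s) (S : Finset F)
    (hS : Set.InjOn (fun p : F × ℕ => ω ^ p.2 * p.1) ((S : Set F) ×ˢ Set.Iio t)) :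
    (t - s + 1) * ∑ α ∈ S, (s - (foldedWronskianAt t n ω α * A).rank) ≤ s * (n - 1) := by
  set m : F → ℕ := fun α => s - (foldedWronskianAt t n ω α * A).rank with hm
  have hne : foldedDet ω (colPoly A) ≠ 0 :=
    foldedDet_ne_zero hω _ (linearIndependent_colPoly hA) (natDegree_colPoly_lt hn A)
  have hdvd : ∏ p ∈ S ×ˢ Finset.range (t - s + 1), (X - C (ω ^ p.2 * p.1)) ^ m p.1 ∣
      foldedDet ω (colPoly A) := by
    refine Finset.prod_dvd_of_coprime ?_ ?_
    · intro p hp q hq hpq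
      simp only [Finset.coe_product, Set.mem_prod, Finset.mem_coe, Finset.mem_range] at hp hq
      refine IsCoprime.pow (isCoprime_X_sub_C_of_isUnit_sub ?_)
      refine (sub_ne_zero.2 fun h => hpq (hS ?_ ?_ h)).isUnit
      · exact ⟨hp.1, Set.mem_Iio.2 (by omega)⟩
      · exact ⟨hq.1, Set.mem_Iio.2 (by omega)⟩
    · intro p hp
      rw [Finset.mem_product, Finset.mem_range] at hp
      exact X_sub_C_pow_dvd_foldedDet ω p.1 A (by omega)
  have hdeg := natDegree_le_of_dvd hdvd hne
  rw [natDegree_prod_of_monic _ _ fun p _ => (monic_X_sub_C _).pow _] at hdeg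
  simp only [natDegree_pow, natDegree_X_sub_C, mul_one] at hdeg
  rw [Finset.sum_product] at hdeg
  simp only [Finset.sum_const, Finset.card_range, smul_eq_mul] at hdeg
  rw [Finset.mul_sum]
  exact hdeg.trans (natDegree_foldedDet_le ω _ (natDegree_colPoly_lt hn A))

end Determinants

end RankCondenser

namespace RankCondenser

open Polynomial Matrix

/-! ### Condensers from folded Wronskians -/

section Condensers

variable {F : Type u} [Field F]

theorem OrderAtLeast.injOn {ω : F} {m : ℕ} (h : OrderAtLeast ω m) :
    Set.InjOn (fun j : ℕ => ω ^ j) (Set.Iio m) := by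
  rcases h.2 with h0 | hm
  · intro i _ j _ hij
    have hfin : ¬ IsOfFinOrder ω := orderOf_eq_zero_iff.1 h0
    have hu : orderOf (Units.mk0 ω h.1) = 0 := by rw [← orderOf_units]; exact h0
    refine (pow_inj_iff_of_orderOf_eq_zero hu).1 (Units.ext ?_)
    simpa using hij
  · exact pow_injOn_Iio_orderOf.mono (Set.Iio_subset_Iio hm)

/-- More points than the degree of the folded determinant: some point is not a root. -/
theorem exists_rank_eq_of_sq_le_encard {n t s : ℕ} {ω : F} {S : Set F} (hn : 1 ≤ n)
    (hsn : s ≤ n) (hst : s ≤ t) (hω : Set.InjOn (fun j : ℕ => ω ^ j) (Set.Iio n))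
    (hS : ((n ^ 2 : ℕ) : ℕ∞) ≤ S.encard) {A : Matrix (Fin n) (Fin s) F} (hA : A.rank = s) :
    ∃ α ∈ S, s ≤ (foldedWronskianAt t n ω α * A).rank := by
  classical
  by_contra! hbad
  have hne : foldedDet ω (colPoly A) ≠ 0 :=
    foldedDet_ne_zero hω _ (linearIndependent_colPoly hA) (natDegree_colPoly_lt hn A)
  have hsub : S ⊆ ((foldedDet ω (colPoly A)).roots.toFinset : Set F) := by
    intro α hα
    have hdvd := X_sub_C_pow_dvd_foldedDet (t := t) ω α A (j := 0) (by omega)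
    rw [pow_zero, one_mul] at hdvd
    rw [Finset.mem_coe, Multiset.mem_toFinset, mem_roots hne, ← dvd_iff_isRoot]
    exact (dvd_pow_self _ (Nat.sub_ne_zero_of_lt (hbad α hα))).trans hdvd
  have h1 := hS.trans (Set.encard_le_encard hsub)
  rw [Set.encard_coe_eq_coe_finsetCard, Nat.cast_le] at h1
  have h2 := (Multiset.toFinset_card_le _).trans (card_roots' (foldedDet ω (colPoly A)))
  have h3 := natDegree_foldedDet_le ω _ (natDegree_colPoly_lt hn A)
  have h4 : s * (n - 1) ≤ n * (n - 1) := Nat.mul_le_mul_right _ hsn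
  have h5 : n * (n - 1) < n * n := Nat.mul_lt_mul_of_pos_left (by omega) (by omega)
  rw [sq] at h1
  omega

/-- If every point of `S` lost more than `ε * s` dimensions, then the folded determinant would have
at least `n` zeros per unit of `s`. -/
theorem exists_rank_ge_of_seedSize_le_encard {n t r s : ℕ} {ε : ℝ} {ω : F} {S : Set F}
    (hs : 1 ≤ s) (hsr : s ≤ r) (hrn : r ≤ n) (hrt : r ≤ t) (hε : 0 < ε)
    (hω : Set.InjOn (fun j : ℕ => ω ^ j) (Set.Iio n))
    (hS : (seedSize n t r ε : ℕ∞) ≤ S.encard)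
    (hinj : Set.InjOn (fun p : F × ℕ => ω ^ p.2 * p.1) (S ×ˢ Set.Iio t))
    {A : Matrix (Fin n) (Fin s) F} (hA : A.rank = s) :
    ∃ α ∈ S, (1 - ε) * (s : ℝ) ≤ ((foldedWronskianAt t n ω α * A).rank : ℝ) := by
  by_contra! hbad
  -- `S` may be infinite, so the corank is summed over a subset of exactly `N` points.
  obtain ⟨S₀, hsub, hcard⟩ := Set.exists_subset_encard_eq hS
  have hfin : S₀.Finite := Set.finite_of_encard_eq_coe hcard
  obtain ⟨T, rfl⟩ := hfin.exists_finset_coe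
  rw [Set.encard_coe_eq_coe_finsetCard, Nat.cast_inj] at hcard
  have hsum := sum_corank_mul_le (t := t) (by omega) hs (hsr.trans hrt) hω hA T
    (hinj.mono (Set.prod_mono hsub subset_rfl))
  have hlow : (T.card : ℝ) * (ε * s) ≤
      ((∑ α ∈ T, (s - (foldedWronskianAt t n ω α * A).rank) : ℕ) : ℝ) := by
    rw [Nat.cast_sum, ← nsmul_eq_mul]
    refine Finset.card_nsmul_le_sum _ _ _ fun α hα => ?_
    have h1 := hbad α (hsub hα)
    have h2 : ((foldedWronskianAt t n ω α * A).rank : ℝ) ≤ s := by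
      exact_mod_cast (rank_mul_le_right _ _).trans hA.le
    rw [Nat.cast_sub (by exact_mod_cast h2)]
    linarith
  have hsumR : ((t : ℝ) - s + 1) *
      ((∑ α ∈ T, (s - (foldedWronskianAt t n ω α * A).rank) : ℕ) : ℝ) ≤ s * ((n : ℝ) - 1) := by
    have := (Nat.cast_le (α := ℝ)).2 hsum
    rw [Nat.cast_mul, Nat.cast_mul, Nat.cast_add, Nat.cast_sub (hsr.trans hrt),
      Nat.cast_sub (by omega : 1 ≤ n)] at this
    simpa using this
  have hsR : (s : ℝ) ≤ r := by exact_mod_cast hsr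
  have hs0 : (0 : ℝ) < s := by exact_mod_cast hs
  have hrR : (r : ℝ) ≤ t := by exact_mod_cast hrt
  have hN : (n : ℝ) ≤ T.card * (ε * ((t : ℝ) - r + 1)) := by
    have h := Nat.le_ceil ((n : ℝ) / (ε * ((t : ℝ) - r + 1)))
    rw [hcard]
    exact (div_le_iff₀ (mul_pos hε (by linarith))).1 h
  have h1 : ((t : ℝ) - r + 1) * (T.card * (ε * s)) ≤ s * ((n : ℝ) - 1) := by
    refine le_trans ?_ hsumR
    exact mul_le_mul (by linarith) hlow (by positivity) (by linarith)
  have h2 := mul_le_mul_of_nonneg_left hN hs0.le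
  nlinarith

theorem isLossyCondenserLE_foldedWronskianAt {ω : F} {n t r : ℕ} {ε : ℝ} {S : Set F}
    (hr : 1 ≤ r) (hrn : r ≤ n) (hrt : r ≤ t) (hε : 0 < ε) (hω : OrderAtLeast ω n)
    (hS : ((n ^ 2 : ℕ) : ℕ∞) ≤ S.encard ∨
      ((seedSize n t r ε : ℕ∞) ≤ S.encard ∧
        Set.InjOn (fun p : F × ℕ => ω ^ p.2 * p.1) (S ×ˢ Set.Iio t))) :
    IsLossyCondenserLE (fun α : S => foldedWronskianAt t n ω (α : F)) r ε := by
  intro s hs hsr A hA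
  rw [hA]
  rcases hS with hS | ⟨hS, hinj⟩
  · obtain ⟨α, hα, h⟩ := exists_rank_eq_of_sq_le_encard (t := t) (by omega) (hsr.trans hrn)
      (hsr.trans hrt) hω.injOn hS hA
    refine ⟨⟨α, hα⟩, ?_⟩
    have h' : (s : ℝ) ≤ ((foldedWronskianAt t n ω α * A).rank : ℝ) := by exact_mod_cast h
    have : 0 ≤ ε * (s : ℝ) := by positivity
    linarith
  · obtain ⟨α, hα, h⟩ := exists_rank_ge_of_seedSize_le_encard hs hsr hrn hrt hε hω.injOn hS hinj hA
    exact ⟨⟨α, hα⟩, h⟩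

theorem injOn_pow_pow {ω : F} {t K : ℕ} (ht : 1 ≤ t) (hK : OrderAtLeast ω (t * K)) :
    Set.InjOn (fun j : ℕ => (ω ^ t) ^ j) (Set.Iio K) := by
  intro i hi j hj hij
  simp only [← pow_mul] at hij
  refine Nat.eq_of_mul_eq_mul_left ht (hK.injOn ?_ ?_ hij)
  · exact Nat.mul_lt_mul_of_pos_left hi ht
  · exact Nat.mul_lt_mul_of_pos_left hj ht

/-- The points `ω ^ i * (ω ^ t) ^ j` with `i < t` and `j < K` are the powers of `ω` with exponent
less than `t * K`, each occurring once. -/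
theorem injOn_folded_points {ω : F} {t K : ℕ} (hK : OrderAtLeast ω (t * K)) :
    Set.InjOn (fun p : F × ℕ => ω ^ p.2 * p.1)
      (((fun j : ℕ => (ω ^ t) ^ j) '' Set.Iio K) ×ˢ Set.Iio t) := by
  rintro ⟨_, i⟩ ⟨⟨j, hj, rfl⟩, hi⟩ ⟨_, i'⟩ ⟨⟨j', hj', rfl⟩, hi'⟩ h
  simp only [Set.mem_Iio] at hi hi' hj hj'
  simp only [← pow_mul, ← pow_add] at h
  have hlt : ∀ {a b : ℕ}, a < t → b < K → a + t * b < t * K := by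
    intro a b ha hb
    calc a + t * b < t + t * b := by omega
      _ = t * (b + 1) := by ring
      _ ≤ t * K := Nat.mul_le_mul_left t hb
  have heq : i + t * j = i' + t * j' := hK.injOn (hlt hi hj) (hlt hi' hj') h
  have h1 : i = i' := by
    have := congrArg (· % t) heq
    simpa [Nat.mod_eq_of_lt hi, Nat.mod_eq_of_lt hi'] using this
  subst h1
  have h2 : j = j' := Nat.eq_of_mul_eq_mul_left (by omega) (Nat.add_left_cancel heq)
  rw [h2]

theorem isLossyCondenserLE_foldedWronskianAt_pow {ω : F} {n t r K : ℕ} {ε : ℝ}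
    (hr : 1 ≤ r) (hrn : r ≤ n) (hrt : r ≤ t) (hε : 0 < ε) (hω : OrderAtLeast ω n)
    (hK : OrderAtLeast ω (t * K)) (hmin : min (seedSize n t r ε) (n ^ 2) ≤ K) :
    IsLossyCondenserLE (fun j : Fin K => foldedWronskianAt t n ω ((ω ^ t) ^ (j : ℕ))) r ε := by
  have hcard : ((fun j : ℕ => (ω ^ t) ^ j) '' Set.Iio K).encard = (K : ℕ∞) := by
    rw [(injOn_pow_pow (hr.trans hrt) hK).encard_image]
    simp [← Set.coe_fintypeCard]
  have h := isLossyCondenserLE_foldedWronskianAt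
    (S := (fun j : ℕ => (ω ^ t) ^ j) '' Set.Iio K) (ε := ε) hr hrn hrt hε hω (by
      rw [hcard, Nat.cast_le, Nat.cast_le]
      rcases min_le_iff.1 hmin with h | h
      · exact Or.inr ⟨h, injOn_folded_points hK⟩
      · exact Or.inl h)
  intro s hs hsr A hA
  obtain ⟨⟨_, j, hj, rfl⟩, hrank⟩ := h s hs hsr A hA
  exact ⟨⟨j, hj⟩, hrank⟩

/-! ### Elements of large multiplicative order -/

theorem orderAtLeast_iff {ω : F} {m : ℕ} :
    OrderAtLeast ω m ↔ ω ≠ 0 ∧ ∀ k, 1 ≤ k → k < m → ω ^ k ≠ 1 := by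
  refine and_congr_right fun _ => ⟨?_, fun h => ?_⟩
  · rintro (h | h) k hk hkm hp
    · exact (orderOf_eq_zero_iff'.1 h) k hk hp
    · exact absurd (Nat.le_of_dvd hk (orderOf_dvd_of_pow_eq_one hp)) (by omega)
  · by_contra! hlt
    exact h _ (Nat.pos_of_ne_zero hlt.1) hlt.2 (pow_orderOf_eq_one ω)

theorem OrderAtLeast.mono {ω : F} {m m' : ℕ} (h : OrderAtLeast ω m) (hm : m' ≤ m) :
    OrderAtLeast ω m' :=
  ⟨h.1, h.2.imp_right hm.trans⟩

/-- Among the first `m ^ 2 + 1` listed elements there is one of order at least `m`.  If the field is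
larger than `m ^ 2`, the polynomial `X * ∏ (X ^ k - 1)`, `1 ≤ k < m`, is too short to vanish at all
of them; otherwise the field is finite, all its elements have been listed, and a generator of its
multiplicative group is among them. -/
theorem exists_orderAtLeast_of_listsDistinct {e : ℕ → F} (he : ListsDistinct e) {m : ℕ}
    (hm : 1 ≤ m) (hcard : (m : ℕ∞) < ENat.card F) :
    ∃ j ≤ m ^ 2, OrderAtLeast (e j) m := by
  classical
  by_cases hbig : ((m ^ 2 : ℕ) : ℕ∞) < ENat.card F
  · by_contra! hbad
    set p : F[X] := X * ∏ k ∈ Finset.Ico 1 m, (X ^ k - 1) with hp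
    have hmonic : p.Monic := by
      refine monic_X.mul (monic_prod_of_monic _ _ fun k hk => ?_)
      exact monic_X_pow_sub_C 1 (by have := (Finset.mem_Ico.1 hk).1; omega)
    have hdeg : p.natDegree ≤ m ^ 2 := by
      refine natDegree_mul_le.trans ?_
      have h1 : (∏ k ∈ Finset.Ico 1 m, (X ^ k - 1 : F[X])).natDegree ≤
          ∑ k ∈ Finset.Ico 1 m, (m - 1) := by
        refine natDegree_prod_le_sum _ _ _ fun k hk => ?_
        rw [← C_1, natDegree_X_pow_sub_C]
        have := (Finset.mem_Ico.1 hk).2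
        omega
      rw [Finset.sum_const, Nat.card_Ico, smul_eq_mul] at h1
      rw [natDegree_X]
      obtain ⟨q, rfl⟩ : ∃ q, m = q + 1 := ⟨m - 1, by omega⟩
      simp only [Nat.add_sub_cancel] at h1
      nlinarith
    have hroot : (Finset.range (m ^ 2 + 1)).image e ⊆ p.roots.toFinset := by
      intro x hx
      obtain ⟨j, hj, rfl⟩ := Finset.mem_image.1 hx
      have hj' := hbad j (by rw [Finset.mem_range] at hj; omega)
      rw [orderAtLeast_iff] at hj'
      rw [Multiset.mem_toFinset, mem_roots hmonic.ne_zero, IsRoot.def, hp, eval_mul, eval_X,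
        eval_prod]
      by_cases h0 : e j = 0
      · rw [h0, zero_mul]
      · push Not at hj'
        obtain ⟨k, hk1, hkm, hk⟩ := hj' h0
        rw [Finset.prod_eq_zero (Finset.mem_Ico.2 ⟨hk1, hkm⟩) (by simp [hk]), mul_zero]
    have hinj : Set.InjOn e (Finset.range (m ^ 2 + 1)) := by
      have key : ∀ {i j : ℕ}, j < m ^ 2 + 1 → i < j → e i ≠ e j := fun hj hij =>
        he _ _ hij (lt_of_le_of_lt (Nat.cast_le.2 (Nat.lt_succ_iff.1 hj)) hbig)
      intro i hi j hj hij
      simp only [Finset.coe_range, Set.mem_Iio] at hi hj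
      rcases lt_trichotomy i j with h | h | h
      · exact absurd hij (key hj h)
      · exact h
      · exact absurd hij.symm (key hi h)
    have h1 := Finset.card_le_card hroot
    rw [Finset.card_image_of_injOn hinj, Finset.card_range] at h1
    have h2 := (Multiset.toFinset_card_le _).trans (card_roots' p)
    omega
  · have hfin : Finite F := by
      rw [← not_infinite_iff_finite]
      intro hinf
      rw [ENat.card_eq_top_of_infinite] at hbig
      exact hbig (ENat.natCast_lt_top _)
    have := Fintype.ofFinite F
    rw [ENat.card_eq_coe_fintype_card, Nat.cast_lt] at hbig hcard
    have hinj : Function.Injective fun i : Fin (Fintype.card F) => e i := by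
      have key : ∀ {i j : Fin (Fintype.card F)}, i < j → e i ≠ e j := fun {i j} hij =>
        he _ _ hij (by rw [ENat.card_eq_coe_fintype_card]; exact Nat.cast_lt.2 j.2)
      intro i j hij
      rcases lt_trichotomy i j with h | h | h
      · exact absurd hij (key h)
      · exact h
      · exact absurd hij.symm (key h)
    have hsurj := ((Fintype.bijective_iff_injective_and_card _).2 ⟨hinj, by simp⟩).2
    obtain ⟨g, hg⟩ := IsCyclic.exists_generator (α := Fˣ)
    obtain ⟨j, hj⟩ := hsurj (g : F)
    refine ⟨j, by have := j.2; omega, ?_⟩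
    simp only at hj
    rw [hj]
    refine ⟨g.ne_zero, Or.inr ?_⟩
    rw [orderOf_units, orderOf_eq_card_of_forall_mem_zpowers hg, Nat.card_eq_fintype_card,
      Fintype.card_units]
    omega

end Condensers

end RankCondenser

namespace RankCondenser

open Polynomial Matrix

/-! ### A time-bounded program logic -/

section Logic

variable {F : Type u} [Field F] {e : ℕ → F}

/-- Total correctness with a time bound: started in `s`, the program halts within `T` steps in a
state satisfying `Q`. -/
def Runs (e : ℕ → F) (p : Program) (s : State F) (T : ℕ) (Q : State F → Prop) : Prop :=
  ∃ (s' : State F) (k : ℕ), Exec e p s s' k ∧ k ≤ T ∧ Q s'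

theorem Runs.mono {p : Program} {s : State F} {T T' : ℕ} {Q Q' : State F → Prop}
    (h : Runs e p s T Q) (hT : T ≤ T') (hQ : ∀ s', Q s' → Q' s') : Runs e p s T' Q' := by
  obtain ⟨s', k, hx, hk, hq⟩ := h
  exact ⟨s', k, hx, hk.trans hT, hQ s' hq⟩

theorem Runs.skip {s : State F} {Q : State F → Prop} (h : Q s) : Runs e .skip s 0 Q :=
  ⟨s, 0, .skip s, le_rfl, h⟩

theorem Runs.seq {p q : Program} {s : State F} {T T' : ℕ} {Q R : State F → Prop}
    (hp : Runs e p s T Q) (hq : ∀ s', Q s' → Runs e q s' T' R) :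
    Runs e (.seq p q) s (T + T') R := by
  obtain ⟨s', k, hx, hk, hs⟩ := hp
  obtain ⟨s'', l, hy, hl, hr⟩ := hq s' hs
  exact ⟨s'', k + l, .seq hx hy, add_le_add hk hl, hr⟩

theorem Runs.ite {c : Test} {p q : Program} {s : State F} {T : ℕ} {Q : State F → Prop}
    (hp : c.Holds s → Runs e p s T Q) (hq : ¬ c.Holds s → Runs e q s T Q) :
    Runs e (.ite c p q) s (T + 1) Q := by
  by_cases hc : c.Holds s
  · obtain ⟨s', k, hx, hk, hs⟩ := hp hc
    exact ⟨s', k + 1, .iteTrue hc hx, Nat.succ_le_succ hk, hs⟩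
  · obtain ⟨s', k, hx, hk, hs⟩ := hq hc
    exact ⟨s', k + 1, .iteFalse hc hx, Nat.succ_le_succ hk, hs⟩

/-- A loop that makes exactly `N` rounds, with an invariant indexed by the number of rounds made. -/
theorem Runs.loop {c : Test} {p : Program} {N B : ℕ} (I : ℕ → State F → Prop)
    (hbody : ∀ j s, j < N → I j s → c.Holds s ∧ Runs e p s B (I (j + 1)))
    (hexit : ∀ s, I N s → ¬ c.Holds s) {s : State F} (hs : I 0 s) :
    Runs e (.loop c p) s (N * (B + 1) + 1) (I N) := by
  have key : ∀ d j s, j + d = N → I j s → Runs e (.loop c p) s (d * (B + 1) + 1) (I N) := by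
    intro d
    induction d with
    | zero =>
      intro j s hj hI
      obtain rfl : j = N := by omega
      exact ⟨s, 1, .loopFalse (hexit s hI), by omega, hI⟩
    | succ d ih =>
      intro j s hj hI
      obtain ⟨hc, s', k, hx, hk, hI'⟩ := hbody j s (by omega) hI
      obtain ⟨s'', l, hy, hl, hQ⟩ := ih (j + 1) s' (by omega) hI'
      refine ⟨s'', k + l + 1, .loopTrue hc hx hy, ?_, hQ⟩
      rw [Nat.succ_mul]
      omega
  exact key N 0 s (zero_add N) hs

/-- A list of instructions, executed one after the other. -/
def block : List Instr → Program
  | [] => .skip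
  | i :: l => .seq (.instr i) (block l)

theorem Runs.block {l : List Instr} {s : State F} {Q : State F → Prop}
    (h : Q (l.foldl (Instr.apply e) s)) : Runs e (block l) s l.length Q := by
  induction l generalizing s with
  | nil => exact Runs.skip h
  | cons i l ih =>
    obtain ⟨s', k, hx, hk, hs⟩ := ih (s := i.apply e s) h
    refine ⟨s', 1 + k, .seq (.instr i s) hx, ?_, hs⟩
    rw [List.length_cons]
    omega

/-- Register `a` receives the product of the registers `b` and `c`; register `d` counts the rounds,
and register `o` holds the number one. -/
def mulProgram (a b c d o : ℕ) : Program :=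
  .seq (block [.natConst a 0, .natConst d 0])
    (.loop (.natLt d b) (block [.natAdd a a c, .natAdd d d o]))

theorem runs_mulProgram {a b c d o : ℕ} (hab : a ≠ b) (hac : a ≠ c) (had : a ≠ d) (hao : a ≠ o)
    (hbd : b ≠ d) (hcd : c ≠ d) (hod : o ≠ d) {s : State F} (ho : s.nat o = 1) :
    Runs e (mulProgram a b c d o) s (3 * s.nat b + 3) fun s' =>
      s' = { s with
        nat := Function.update (Function.update s.nat a (s.nat b * s.nat c)) d (s.nat b) } := by
  refine Runs.mono (Runs.seq (Q := fun s' => s' = { s with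
    nat := Function.update (Function.update s.nat a (0 * s.nat c)) d 0 }) (Runs.block ?_)
    fun s' hs' => Runs.loop (N := s.nat b) (B := 2) (fun j s' => s' = { s with
      nat := Function.update (Function.update s.nat a (j * s.nat c)) d j }) ?_ ?_ hs') ?_
    fun s' h => h
  · simp [Instr.apply]
  · rintro j _ hj rfl
    refine ⟨?_, Runs.block ?_⟩
    · simpa [Test.Holds, hab.symm, hbd] using hj
    · simp only [List.foldl, Instr.apply, State.mk.injEq, and_true]
      funext x
      by_cases h1 : x = d
      · subst h1
        simp [hod, hao.symm, ho, had.symm]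
      · by_cases h2 : x = a
        · subst h2
          simp [had, hac.symm, hcd, add_mul]
        · simp [h1, h2]
  · rintro _ rfl
    simp [Test.Holds, hab.symm, hbd]
  · simp only [List.length_cons, List.length_nil]
    omega

end Logic

/-! ### The program for the condenser -/

/-- Tries the next listed element of the field: it is fetched into the field register `0`, and the
flag in register `8` is set if and only if the element is nonzero and none of its powers with
exponent between `1` and `m - 1` is `1`, where `m` is in register `6`. -/
def searchBody : Program :=
  .seq (block [.fldElem 0 9, .natMove 8 4, .fldMove 1 3, .natMove 7 4])
    (.seq (.ite (.fldEq 0 2) (block [.natConst 8 0]) .skip)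
      (.seq (.loop (.natLt 7 6) (.seq (block [.fldMul 1 1 0])
          (.seq (.ite (.fldEq 1 3) (block [.natConst 8 0]) .skip) (block [.natAdd 7 7 4]))))
        (block [.natAdd 9 9 4])))

/-- Sets up the constants and computes `n ^ 2` and `t * n ^ 2` into the registers `5` and `6`. -/
def setupProgram : Program :=
  .seq (block [.natConst 4 1, .fldZero 2, .fldOne 3, .natConst 8 0, .natConst 9 0, .natConst 10 0,
      .fldZero 6])
    (.seq (mulProgram 5 0 0 7 4) (mulProgram 6 1 5 7 4))

/-- Computes the exponent of the evaluation point and the mask: `t * i` and `1` if `i < n ^ 2`, and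
`0` and `0` otherwise. -/
def pointProgram : Program :=
  .ite (.natLt 3 5) (.seq (mulProgram 10 1 3 7 4) (block [.fldOne 6])) .skip

/-- Raises the element in the field register `0` to the power in register `10`. -/
def powProgram : Program :=
  .seq (block [.fldOne 4, .natConst 7 0])
    (.loop (.natLt 7 10) (block [.fldMul 4 4 0, .natAdd 7 7 4]))

/-- Writes the rows of the matrix.  The field register `4` holds the base of the current row, the
field register `5` the current entry, which starts with the mask. -/
def writeProgram : Program :=
  .seq (block [.natConst 11 0])
    (.loop (.natLt 11 1) (.seq (block [.fldMove 5 6, .natConst 12 0])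
      (.seq (.loop (.natLt 12 0) (block [.write 5, .fldMul 5 5 4, .natAdd 12 12 4]))
        (block [.fldMul 4 4 0, .natAdd 11 11 4]))))

/-- The program: searches the list of field elements for one of order at least `t * n ^ 2` and
writes the requested matrix.  The number registers `0`, `1`, `2`, `3` hold the input `n`, `t`, `M`,
`i`; register `4` holds `1`, register `5` holds `n ^ 2`, register `6` holds `t * n ^ 2`, register `7`
is the counter of the inner loops, `8` the flag and `9` the position of the search, `10` the exponent
of the evaluation point, and `11` and `12` count rows and columns.  The field registers are `0` for
`ω`, `1` for its powers, `2` and `3` for the constants `0` and `1`, `4` for the base of the current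
row, `5` for the current entry, and `6` for the mask, which is `0` if the matrix is to be zero. -/
def condenserProgram : Program :=
  .seq setupProgram (.seq (.loop (.natLt 8 4) searchBody)
    (.seq pointProgram (.seq powProgram writeProgram)))

theorem rowMajor_of {R : Type u} {t n : ℕ} (g : ℕ → ℕ → R) :
    rowMajor (Matrix.of fun (a : Fin t) (b : Fin n) => g a b) =
      ((List.range t).map fun a => (List.range n).map fun b => g a b).flatten := by
  have key : ∀ {α : Type u} (k : ℕ) (f : ℕ → α),
      List.ofFn (fun i : Fin k => f i) = (List.range k).map f := by
    intro α k f
    apply List.ext_getElem <;> simp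
  simp only [rowMajor, of_apply]
  rw [← key t]
  congr 2
  funext a
  exact key n _

section Correctness

variable {F : Type u} [Field F] {e : ℕ → F}

/-- The registers that keep their values from the setup to the end of the search.  The exponent in
register `10` and the mask in the field register `6` are preset for the case of a zero matrix. -/
structure IsSetUp (n t i : ℕ) (s : State F) : Prop where
  nat0 : s.nat 0 = n
  nat1 : s.nat 1 = t
  nat3 : s.nat 3 = i
  nat4 : s.nat 4 = 1
  nat5 : s.nat 5 = n * n
  nat6 : s.nat 6 = t * (n * n)
  nat10 : s.nat 10 = 0
  fld2 : s.fld 2 = 0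
  fld3 : s.fld 3 = 1
  fld6 : s.fld 6 = 0
  out : s.out = []

theorem runs_setupProgram (n t M i : ℕ) :
    Runs e setupProgram (startState F [n, t, M, i]) (7 + ((3 * n + 3) + (3 * t + 3)))
      fun s => IsSetUp n t i s ∧ s.nat 8 = 0 ∧ s.nat 9 = 0 := by
  refine Runs.seq (Q := fun s => s.nat 0 = n ∧ s.nat 1 = t ∧ s.nat 3 = i ∧ s.nat 4 = 1 ∧
    s.nat 8 = 0 ∧ s.nat 9 = 0 ∧ s.nat 10 = 0 ∧ s.fld 2 = 0 ∧ s.fld 3 = 1 ∧ s.fld 6 = 0 ∧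
    s.out = []) (Runs.block ?_) ?_
  · simp [Instr.apply, startState]
  · rintro s ⟨h0, h1, h3, h4, h8, h9, h10, f2, f3, f6, ho⟩
    refine Runs.seq (Runs.mono (runs_mulProgram (by decide) (by decide) (by decide) (by decide)
      (by decide) (by decide) (by decide) h4) (by rw [h0]) fun s' h => h) ?_
    rintro _ rfl
    refine Runs.mono (runs_mulProgram (by decide) (by decide) (by decide) (by decide)
      (by decide) (by decide) (by decide) (by simp [h4])) ?_ ?_
    · simp [h1]
    · rintro _ rfl
      refine ⟨⟨?_, ?_, ?_, ?_, ?_, ?_, ?_, f2, f3, f6, ho⟩, ?_, ?_⟩ <;>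
        simp [h0, h1, h3, h4, h8, h9, h10]

open Classical in
theorem runs_searchBody {n t i : ℕ} (hm : 1 ≤ t * (n * n)) {s : State F} (hs : IsSetUp n t i s) :
    Runs e searchBody s (4 + ((1 + 1) + (((t * (n * n) - 1) * ((1 + ((1 + 1) + 1)) + 1) + 1) + 1)))
      fun s' => IsSetUp n t i s' ∧ s'.nat 9 = s.nat 9 + 1 ∧ s'.fld 0 = e (s.nat 9) ∧
        s'.nat 8 = if OrderAtLeast (e (s.nat 9)) (t * (n * n)) then 1 else 0 := by
  set x := e (s.nat 9) with hx
  refine Runs.seq (Q := fun s' => IsSetUp n t i s' ∧ s'.nat 9 = s.nat 9 ∧ s'.fld 0 = x ∧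
    s'.nat 8 = 1 ∧ s'.fld 1 = 1 ∧ s'.nat 7 = 1) (Runs.block ?_) ?_
  · obtain ⟨h0, h1, h3, h4, h5, h6, h10, f2, f3, f6, ho⟩ := hs
    refine ⟨⟨?_, ?_, ?_, ?_, ?_, ?_, ?_, ?_, ?_, ?_, ?_⟩, ?_, ?_, ?_, ?_, ?_⟩ <;>
      simp [Instr.apply, *]
  rintro s₁ ⟨hs₁, h9, f0, h8, f1, h7⟩
  -- After `j` rounds the powers with exponents `1, …, j` have been compared with `1`.
  set I : ℕ → State F → Prop := fun j s' => IsSetUp n t i s' ∧ s'.nat 9 = s.nat 9 ∧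
    s'.fld 0 = x ∧ s'.fld 1 = x ^ j ∧ s'.nat 7 = j + 1 ∧
    s'.nat 8 = if x ≠ 0 ∧ ∀ k, 1 ≤ k → k < j + 1 → x ^ k ≠ 1 then 1 else 0 with hI
  refine Runs.seq (Q := I 0) (Runs.ite ?_ ?_) fun s₂ hs₂ =>
    Runs.seq (Runs.loop (N := t * (n * n) - 1) I ?_ ?_ hs₂) ?_
  · intro hc
    simp only [Test.Holds, f0, hs₁.fld2] at hc
    refine Runs.block ?_
    obtain ⟨h0, h1, h3, h4, h5, h6, h10, f2, f3, f6, ho⟩ := hs₁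
    refine ⟨⟨?_, ?_, ?_, ?_, ?_, ?_, ?_, ?_, ?_, ?_, ?_⟩, ?_, ?_, ?_, ?_, ?_⟩ <;>
      simp [Instr.apply, h0, h1, h3, h4, h5, h6, h10, f2, f3, f6, ho, h9,
        f0, f1, h7, hc]
  · intro hc
    simp only [Test.Holds, f0, hs₁.fld2] at hc
    refine (Runs.skip ?_).mono (Nat.zero_le _) fun _ h => h
    refine ⟨hs₁, h9, f0, by rw [f1, pow_zero], h7, ?_⟩
    rw [h8, if_pos ⟨hc, fun k hk hk' => by omega⟩]
  · rintro j s₃ hj ⟨hs₃, h9, f0, f1, h7, h8⟩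
    refine ⟨by simp only [Test.Holds, h7, hs₃.nat6]; omega, ?_⟩
    refine Runs.seq (Q := fun s' => IsSetUp n t i s' ∧ s'.nat 9 = s.nat 9 ∧
      s'.fld 0 = x ∧ s'.fld 1 = x ^ (j + 1) ∧ s'.nat 7 = j + 1 ∧
      s'.nat 8 = if x ≠ 0 ∧ ∀ k, 1 ≤ k → k < j + 1 → x ^ k ≠ 1 then 1 else 0)
      (Runs.block ?_) ?_
    · obtain ⟨h0, h1, h3, h4, h5, h6, h10, f2, f3, f6, ho⟩ := hs₃
      refine ⟨⟨?_, ?_, ?_, ?_, ?_, ?_, ?_, ?_, ?_, ?_, ?_⟩, ?_, ?_, ?_, ?_, ?_⟩ <;>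
        simp [Instr.apply, h0, h1, h3, h4, h5, h6, h10, f2, f3, f6, ho, h9,
          f0, f1, h7, h8, pow_succ]
    rintro s₄ ⟨hs₄, h9, f0, f1, h7, h8⟩
    refine (Runs.seq (T' := 1) (Q := fun s' => IsSetUp n t i s' ∧ s'.nat 9 = s.nat 9 ∧
      s'.fld 0 = x ∧ s'.fld 1 = x ^ (j + 1) ∧ s'.nat 7 = j + 1 ∧
      s'.nat 8 = if x ≠ 0 ∧ ∀ k, 1 ≤ k → k < j + 1 + 1 → x ^ k ≠ 1 then 1 else 0)
      (Runs.ite (T := 1) ?_ ?_) ?_).mono le_rfl fun _ h => h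
    · intro hc
      simp only [Test.Holds, f1, hs₄.fld3] at hc
      have hneg : ¬ (x ≠ 0 ∧ ∀ k, 1 ≤ k → k < j + 1 + 1 → x ^ k ≠ 1) :=
        fun h => h.2 (j + 1) (by omega) (by omega) hc
      refine Runs.block ?_
      rw [if_neg hneg]
      obtain ⟨h0, h1, h3, h4, h5, h6, h10, f2, f3, f6, ho⟩ := hs₄
      refine ⟨⟨?_, ?_, ?_, ?_, ?_, ?_, ?_, ?_, ?_, ?_, ?_⟩, ?_, ?_, ?_, ?_, ?_⟩ <;>
        simp [Instr.apply, h0, h1, h3, h4, h5, h6, h10, f2, f3, f6, ho, h9,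
          f0, f1, h7]
    · intro hc
      simp only [Test.Holds, f1, hs₄.fld3] at hc
      refine (Runs.skip ?_).mono (Nat.zero_le _) fun _ h => h
      refine ⟨hs₄, h9, f0, f1, h7, ?_⟩
      have hiff : (∀ k, 1 ≤ k → k < j + 1 → x ^ k ≠ 1) ↔
          ∀ k, 1 ≤ k → k < j + 1 + 1 → x ^ k ≠ 1 := by
        refine forall₂_congr fun k hk => ⟨fun h hk' => ?_, fun h hk' => h (by omega)⟩
        rcases Nat.lt_succ_iff_lt_or_eq.1 hk' with h' | rfl
        · exact h h'
        · exact hc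
      simp only [h8, hiff]
      congr
    · rintro s₅ ⟨hs₅, h9, f0, f1, h7, h8⟩
      refine Runs.block ?_
      obtain ⟨h0, h1, h3, h4, h5, h6, h10, f2, f3, f6, ho⟩ := hs₅
      refine ⟨⟨?_, ?_, ?_, ?_, ?_, ?_, ?_, ?_, ?_, ?_, ?_⟩, ?_, ?_, ?_, ?_, ?_⟩ <;>
        simp [Instr.apply, h0, h1, h3, h4, h5, h6, h10, f2, f3, f6, ho, h9,
          f0, f1, h7, h8]
  · rintro s₃ ⟨hs₃, -, -, -, h7, -⟩
    simp only [Test.Holds, h7, hs₃.nat6]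
    omega
  · rintro s₃ ⟨hs₃, h9, f0, -, -, h8⟩
    refine Runs.block ?_
    rw [Nat.sub_add_cancel hm] at h8
    simp only [orderAtLeast_iff]
    obtain ⟨h0, h1, h3, h4, h5, h6, h10, f2, f3, f6, ho⟩ := hs₃
    refine ⟨⟨?_, ?_, ?_, ?_, ?_, ?_, ?_, ?_, ?_, ?_, ?_⟩, ?_, ?_, ?_⟩ <;>
      simp [Instr.apply, h0, h1, h3, h4, h5, h6, h10, f2, f3, f6, ho, h9,
        f0, h8]

/-- The search stops at the first listed element of order at least `t * n ^ 2`. -/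
theorem runs_search {n t i j₀ : ℕ} (hm : 1 ≤ t * (n * n))
    (hj₀ : OrderAtLeast (e j₀) (t * (n * n)))
    (hmin : ∀ j < j₀, ¬ OrderAtLeast (e j) (t * (n * n))) {s : State F} (hs : IsSetUp n t i s)
    (h8 : s.nat 8 = 0) (h9 : s.nat 9 = 0) :
    Runs e (.loop (.natLt 8 4) searchBody) s ((j₀ + 1) * (5 * (t * (n * n)) + 8) + 1)
      fun s' => IsSetUp n t i s' ∧ s'.fld 0 = e j₀ := by
  classical
  refine (Runs.loop (N := j₀ + 1) (fun j s' => IsSetUp n t i s' ∧ s'.nat 9 = j ∧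
    (s'.nat 8 = if j = j₀ + 1 then 1 else 0) ∧ (j = j₀ + 1 → s'.fld 0 = e j₀))
    ?_ ?_ ⟨hs, h9, by simpa using h8, by omega⟩).mono
    (T := (j₀ + 1) * ((5 * (t * (n * n)) + 7) + 1) + 1) le_rfl fun s' h => ⟨h.1, h.2.2.2 rfl⟩
  · rintro j s' hj ⟨hs', h9, h8, -⟩
    refine ⟨?_, (runs_searchBody hm hs').mono (by omega) ?_⟩
    · simp only [Test.Holds, h8, hs'.nat4]
      rw [if_neg (by omega)]
      exact Nat.one_pos
    · rintro s'' ⟨hs'', h9', f0, h8'⟩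
      rw [h9] at h9' f0 h8'
      refine ⟨hs'', h9', ?_, ?_⟩
      · rw [h8']
        refine if_congr ?_ rfl rfl
        constructor
        · intro h
          by_contra hne
          exact hmin j (by omega) h
        · intro h
          obtain rfl : j = j₀ := by omega
          exact hj₀
      · intro h
        obtain rfl : j = j₀ := by omega
        exact f0
  · rintro s' ⟨hs', -, h8, -⟩
    simp [Test.Holds, h8, hs'.nat4]

/-- The registers that are used once the exponent `T` and the mask `μ` are known. -/
structure IsReady (n t T : ℕ) (ω μ : F) (s : State F) : Prop where
  nat0 : s.nat 0 = n
  nat1 : s.nat 1 = t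
  nat4 : s.nat 4 = 1
  nat10 : s.nat 10 = T
  fld0 : s.fld 0 = ω
  fld6 : s.fld 6 = μ

theorem runs_pointProgram {n t i : ℕ} {ω : F} {s : State F} (hs : IsSetUp n t i s)
    (f0 : s.fld 0 = ω) :
    Runs e pointProgram s ((3 * t + 3) + 1 + 1) fun s' =>
      IsReady n t (if i < n * n then t * i else 0) ω (if i < n * n then 1 else 0) s' ∧
        s'.out = [] := by
  obtain ⟨h0, h1, h3, h4, h5, h6, h10, f2, f3, f6, ho⟩ := hs
  refine Runs.ite ?_ ?_
  · intro hc
    simp only [Test.Holds, h3, h5] at hc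
    refine Runs.seq (T := 3 * t + 3) (T' := 1) (Runs.mono (runs_mulProgram (by decide) (by decide)
      (by decide) (by decide) (by decide) (by decide) (by decide) h4) (by rw [h1]) fun s' h => h) ?_
    rintro _ rfl
    refine Runs.block (l := [.fldOne 6]) ⟨⟨?_, ?_, ?_, ?_, ?_, ?_⟩, ?_⟩ <;>
      simp [Instr.apply, h0, h1, h3, h4, f0, ho, hc]
  · intro hc
    simp only [Test.Holds, h3, h5] at hc
    refine (Runs.skip ?_).mono (Nat.zero_le _) fun _ h => h
    rw [if_neg hc, if_neg hc]
    exact ⟨⟨h0, h1, h4, h10, f0, f6⟩, ho⟩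

theorem runs_powProgram {n t T : ℕ} {ω μ : F} {s : State F} (hs : IsReady n t T ω μ s)
    (ho : s.out = []) :
    Runs e powProgram s (2 + (T * (2 + 1) + 1)) fun s' =>
      IsReady n t T ω μ s' ∧ s'.fld 4 = ω ^ T ∧ s'.out = [] := by
  set I : ℕ → State F → Prop := fun j s' =>
    (IsReady n t T ω μ s' ∧ s'.fld 4 = ω ^ j ∧ s'.out = []) ∧ s'.nat 7 = j with hI
  refine Runs.seq (Q := I 0) (Runs.block ?_) fun s' hs' =>
    (Runs.loop (N := T) I ?_ ?_ hs').mono le_rfl fun _ h => h.1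
  · obtain ⟨h0, h1, h4, h10, f0, f6⟩ := hs
    refine ⟨⟨⟨?_, ?_, ?_, ?_, ?_, ?_⟩, ?_, ?_⟩, ?_⟩ <;>
      simp [Instr.apply, h0, h1, h4, h10, f0, f6, ho]
  · rintro j s' hj ⟨⟨⟨h0, h1, h4, h10, f0, f6⟩, f4, ho⟩, h7⟩
    refine ⟨by simpa only [Test.Holds, h7, h10] using hj, Runs.block ?_⟩
    refine ⟨⟨⟨?_, ?_, ?_, ?_, ?_, ?_⟩, ?_, ?_⟩, ?_⟩ <;>
      simp [Instr.apply, h0, h1, h4, h10, f0, f6, f4, h7, ho, pow_succ]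
  · rintro s' ⟨⟨hs', -⟩, h7⟩
    simp [Test.Holds, h7, hs'.nat10]

theorem runs_writeProgram {n t T : ℕ} {ω μ α : F} {s : State F} (hs : IsReady n t T ω μ s)
    (f4 : s.fld 4 = α) (ho : s.out = []) :
    Runs e writeProgram s (1 + (t * ((2 + ((n * (3 + 1) + 1) + 2)) + 1) + 1)) fun s' =>
      s'.out = ((List.range t).map fun a =>
        (List.range n).map fun b => μ * (α * ω ^ a) ^ b).flatten := by
  set rows : ℕ → List F := fun a => ((List.range a).map fun a =>
    (List.range n).map fun b => μ * (α * ω ^ a) ^ b).flatten with hrows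
  set I : ℕ → State F → Prop := fun j s' =>
    (IsReady n t T ω μ s' ∧ s'.fld 4 = α * ω ^ j ∧ s'.nat 11 = j) ∧ s'.out = rows j with hI
  refine Runs.seq (Q := I 0) (Runs.block ?_) fun s' hs' =>
    (Runs.loop (N := t) I ?_ ?_ hs').mono le_rfl fun _ h => h.2
  · obtain ⟨h0, h1, h4, h10, f0, f6⟩ := hs
    refine ⟨⟨⟨?_, ?_, ?_, ?_, ?_, ?_⟩, ?_, ?_⟩, ?_⟩ <;>
      simp [Instr.apply, h0, h1, h4, h10, f0, f6, f4, ho, hrows]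
  · rintro a s₁ ha ⟨⟨hs₁, f4, h11⟩, ho⟩
    refine ⟨by simpa only [Test.Holds, h11, hs₁.nat1] using ha, ?_⟩
    set J : ℕ → State F → Prop := fun b s' =>
      (IsReady n t T ω μ s' ∧ s'.fld 4 = α * ω ^ a ∧ s'.nat 11 = a) ∧
        s'.fld 5 = μ * (α * ω ^ a) ^ b ∧ s'.nat 12 = b ∧
        s'.out = rows a ++ (List.range b).map fun b => μ * (α * ω ^ a) ^ b with hJ
    refine Runs.seq (Q := J 0) (Runs.block ?_) fun s₂ hs₂ =>
      Runs.seq (Runs.loop (N := n) J ?_ ?_ hs₂) ?_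
    · obtain ⟨h0, h1, h4, h10, f0, f6⟩ := hs₁
      refine ⟨⟨⟨?_, ?_, ?_, ?_, ?_, ?_⟩, ?_, ?_⟩, ?_, ?_, ?_⟩ <;>
        simp [Instr.apply, h0, h1, h4, h10, f0, f6, f4, ho, h11]
    · rintro b s₃ hb ⟨⟨⟨h0, h1, h4, h10, f0, f6⟩, f4, h11⟩, f5, h12, ho⟩
      refine ⟨by simpa only [Test.Holds, h12, h0] using hb, Runs.block ?_⟩
      refine ⟨⟨⟨?_, ?_, ?_, ?_, ?_, ?_⟩, ?_, ?_⟩, ?_, ?_, ?_⟩ <;>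
        simp [Instr.apply, h0, h1, h4, h10, f0, f6, f4, f5, ho, h11, h12,
          pow_succ, mul_assoc, List.range_succ]
    · rintro s₃ ⟨⟨hs₃, -⟩, -, h12, -⟩
      simp [Test.Holds, h12, hs₃.nat0]
    · rintro s₃ ⟨⟨⟨h0, h1, h4, h10, f0, f6⟩, f4, h11⟩, -, -, ho⟩
      refine Runs.block ?_
      refine ⟨⟨⟨?_, ?_, ?_, ?_, ?_, ?_⟩, ?_, ?_⟩, ?_⟩ <;>
        simp [Instr.apply, h0, h1, h4, h10, f0, f6, f4, ho, h11,
          pow_succ, mul_assoc, List.range_succ, hrows]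
  · rintro s' ⟨⟨hs', -, h11⟩, -⟩
    simp [Test.Holds, h11, hs'.nat1]

/-- The family of matrices that the program computes: folded Wronskians at the first `n ^ 2` powers
of `ω ^ t`, then zero matrices. -/
noncomputable def condenserMatrix (t n : ℕ) (ω : F) (i : ℕ) : Matrix (Fin t) (Fin n) F :=
  if i < n ^ 2 then foldedWronskianAt t n ω ((ω ^ t) ^ i) else 0

theorem rowMajor_condenserMatrix (t n : ℕ) (ω : F) (i : ℕ) :
    rowMajor (condenserMatrix t n ω i) = ((List.range t).map fun a => (List.range n).map fun b =>
      (if i < n * n then 1 else 0) *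
        (ω ^ (if i < n * n then t * i else 0) * ω ^ a) ^ b).flatten := by
  rw [← rowMajor_of]
  congr 1
  ext a b
  rw [condenserMatrix, sq]
  split_ifs
  · rw [foldedWronskianAt_apply, of_apply, one_mul, ← pow_mul, mul_comm (ω ^ _)]
  · simp

theorem outputsWithin_condenserProgram {n t i j₀ : ℕ} (M : ℕ) (hm : 1 ≤ t * (n * n))
    (hj₀ : OrderAtLeast (e j₀) (t * (n * n)))
    (hmin : ∀ j < j₀, ¬ OrderAtLeast (e j) (t * (n * n))) (hle : j₀ ≤ (t * (n * n)) ^ 2) :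
    OutputsWithin e condenserProgram [n, t, M, i] (rowMajor (condenserMatrix t n (e j₀) i))
      (100 * (t + n + Nat.log 2 M + 1) ^ 9) := by
  have h : Runs e condenserProgram (startState F [n, t, M, i]) _ fun s' =>
      s'.out = rowMajor (condenserMatrix t n (e j₀) i) :=
    Runs.seq (runs_setupProgram n t M i) fun s₁ h₁ =>
      Runs.seq (runs_search hm hj₀ hmin h₁.1 h₁.2.1 h₁.2.2) fun s₂ h₂ =>
        Runs.seq (runs_pointProgram h₂.1 h₂.2) fun s₃ h₃ =>
          Runs.seq (runs_powProgram h₃.1 h₃.2) fun s₄ h₄ =>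
            (runs_writeProgram h₄.1 h₄.2.1 h₄.2.2).mono le_rfl fun s₅ h₅ => by
              rw [h₅, rowMajor_condenserMatrix]
  obtain ⟨s, k, hx, hk, hs⟩ := h
  refine ⟨s, k, hx, hs, hk.trans ?_⟩
  set X := t + n + Nat.log 2 M + 1 with hX
  have hX1 : 1 ≤ X := by omega
  have hn : n ≤ X := by omega
  have ht : t ≤ X := by omega
  have hmX : t * (n * n) ≤ X ^ 3 :=
    (Nat.mul_le_mul ht (Nat.mul_le_mul hn hn)).trans (by rw [pow_succ, sq, mul_comm])
  have hT : (if i < n * n then t * i else 0) ≤ X ^ 3 := by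
    split_ifs with hi
    · exact (Nat.mul_le_mul_left t hi.le).trans hmX
    · exact Nat.zero_le _
  have hj : j₀ + 1 ≤ 2 * X ^ 6 := by
    have h1 : (t * (n * n)) ^ 2 ≤ (X ^ 3) ^ 2 := Nat.pow_le_pow_left hmX 2
    have h2 : 1 ≤ X ^ 6 := Nat.one_le_pow _ _ hX1
    rw [← pow_mul, show 3 * 2 = 6 from rfl] at h1
    omega
  have hp : ∀ k ≤ 9, X ^ k ≤ X ^ 9 := fun k hk => Nat.pow_le_pow_right hX1 hk
  -- The search dominates: `O(X ^ 6)` candidates, each tested with `O(X ^ 3)` powers.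
  have hsearch : (j₀ + 1) * (5 * (t * (n * n)) + 8) ≤ 26 * X ^ 9 := by
    have h3 : 1 ≤ X ^ 3 := Nat.one_le_pow _ _ hX1
    calc (j₀ + 1) * (5 * (t * (n * n)) + 8) ≤ 2 * X ^ 6 * (13 * X ^ 3) :=
          Nat.mul_le_mul hj (by omega)
      _ = 26 * X ^ 9 := by ring
  have htn : t * n ≤ X ^ 9 := (Nat.mul_le_mul ht hn).trans (by rw [← sq]; exact hp 2 (by decide))
  have h0 := hp 0 (by decide)
  have h1 := hp 1 (by decide)
  have h3 := hp 3 (by decide)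
  rw [pow_zero] at h0
  rw [pow_one] at h1
  have hw : t * ((2 + ((n * (3 + 1) + 1) + 2)) + 1) = 4 * (t * n) + 6 * t := by ring
  rw [hw]
  omega

/-- The first `min M (n ^ 2)` of the matrices already form a condenser. -/
theorem isLossyCondenserLE_condenserMatrix {ω : F} {n t r M : ℕ} {ε : ℝ} (hr : 1 ≤ r)
    (hrn : r ≤ n) (hrt : r ≤ t) (hε : 0 < ε) (hω : OrderAtLeast ω (t * n ^ 2))
    (hM : seedSize n t r ε ≤ M) :
    IsLossyCondenserLE (fun i : Fin M => condenserMatrix t n ω i) r ε := by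
  have hn : n ≤ t * n ^ 2 := by
    calc n = 1 * (n * 1) := by ring
      _ ≤ t * (n * n) := Nat.mul_le_mul (hr.trans hrt) (Nat.mul_le_mul_left n (hr.trans hrn))
      _ = t * n ^ 2 := by ring
  have h := isLossyCondenserLE_foldedWronskianAt_pow (K := min M (n ^ 2)) hr hrn hrt hε
    (hω.mono hn) (hω.mono (Nat.mul_le_mul_left t (min_le_right _ _))) (min_le_min_right _ hM)
  intro s hs hsr A hA
  obtain ⟨j, hj⟩ := h s hs hsr A hA
  refine ⟨⟨j, j.2.trans_le (min_le_left _ _)⟩, ?_⟩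
  simp only [condenserMatrix]
  rwa [if_pos (j.2.trans_le (min_le_right _ _))]

end Correctness

end RankCondenser

open RankCondenser in
theorem mainTheorem3 :
    -- the folded Wronskian at a set `S` of powers of `ω ^ ℓ`
    (∀ (F : Type u) [Field F] (ω : F) (n t r l : ℕ) (ε : ℝ) (S : Set F),
      1 ≤ r → r ≤ n → r ≤ t → 0 < ε → OrderAtLeast ω n → t ≤ l →
      (∀ α ∈ S, ∃ j : ℕ, α = (ω ^ l) ^ j) →
      (((n ^ 2 : ℕ) : ℕ∞) ≤ S.encard ∨
        ((seedSize n t r ε : ℕ∞) ≤ S.encard ∧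
          Set.InjOn (fun p : F × ℕ => ω ^ p.2 * p.1) (S ×ˢ Set.Iio t))) →
      IsLossyCondenserLE (fun α : S => foldedWronskianAt t n ω (α : F)) r ε) ∧
    -- in particular, at the first `K` powers of `ω ^ t`
    (∀ (F : Type u) [Field F] (ω : F) (n t r K : ℕ) (ε : ℝ),
      1 ≤ r → r ≤ n → r ≤ t → 0 < ε → OrderAtLeast ω n → OrderAtLeast ω (t * K) →
      min (seedSize n t r ε) (n ^ 2) ≤ K →
      Set.InjOn (fun j : ℕ => (ω ^ t) ^ j) (Set.Iio K) ∧
      IsLossyCondenserLE (fun j : Fin K => foldedWronskianAt t n ω ((ω ^ t) ^ (j : ℕ))) r ε) ∧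
    -- the explicit condenser of any size `M ≥ N`
    (∃ (P : Program) (C k : ℕ), ∀ (F : Type u) [Field F] (e : ℕ → F), ListsDistinct e →
      ∀ (n t M : ℕ), 1 ≤ n → 1 ≤ t → ((t * n ^ 2 : ℕ) : ℕ∞) < ENat.card F →
      ∃ (ω : F) (E : Fin M → Matrix (Fin t) (Fin n) F),
        OrderAtLeast ω (t * n ^ 2) ∧
        (∀ i : Fin M, (i : ℕ) < n ^ 2 → E i = foldedWronskianAt t n ω ((ω ^ t) ^ (i : ℕ))) ∧
        (∀ i : Fin M, n ^ 2 ≤ (i : ℕ) → E i = 0) ∧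
        (∀ i : Fin M, OutputsWithin e P [n, t, M, (i : ℕ)] (rowMajor (E i))
          (C * (t + n + Nat.log 2 M + 1) ^ k)) ∧
        (∀ (r : ℕ) (ε : ℝ), 1 ≤ r → r ≤ n → r ≤ t → 0 < ε → seedSize n t r ε ≤ M →
          IsLossyCondenserLE E r ε)) := by
  refine ⟨?_, ?_, condenserProgram, 100, 9, ?_⟩
  · intro F _ ω n t r l ε S hr hrn hrt hε hω _ _ hS
    exact isLossyCondenserLE_foldedWronskianAt hr hrn hrt hε hω hS
  · intro F _ ω n t r K ε hr hrn hrt hε hω hK hmin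
    exact ⟨injOn_pow_pow (hr.trans hrt) hK,
      isLossyCondenserLE_foldedWronskianAt_pow hr hrn hrt hε hω hK hmin⟩
  · intro F _ e he n t M hn ht hcard
    classical
    have hm : 1 ≤ t * n ^ 2 := Nat.mul_pos ht (Nat.pow_pos hn)
    obtain ⟨j, hj, hord⟩ := exists_orderAtLeast_of_listsDistinct he hm hcard
    have hex : ∃ j, OrderAtLeast (e j) (t * n ^ 2) := ⟨j, hord⟩
    refine ⟨e (Nat.find hex), fun i => condenserMatrix t n (e (Nat.find hex)) i,
      Nat.find_spec hex, fun i hi => if_pos hi, fun i hi => if_neg (not_lt.2 hi), fun i => ?_,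
      fun r ε hr hrn hrt hε hM =>
        isLossyCondenserLE_condenserMatrix hr hrn hrt hε (Nat.find_spec hex) hM⟩
    refine outputsWithin_condenserProgram M ?_ ?_ (fun j hj => ?_) ?_
    · rwa [← sq]
    · rw [← sq]
      exact Nat.find_spec hex
    · rw [← sq]
      exact Nat.find_min hex hj
    · rw [← sq]
      exact (Nat.find_min' hex hord).trans hj
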